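/- Let $(\mathscr C,\mathbb E,\mathfrak s)$ be an extriangulated category in the sense of Nakaoka and Palu: $\mathscr C$ is an additive category, $\mathbb E\colon\mathscr C^{\mathrm{op}}\times\mathscr C\to Ab$ is a biadditive functor, and $\mathfrak s$ is an additive realisation of $\mathbb E$, which assigns to each $\delta\in\mathbb E(Z,X)$ an equivalence class $\mathfrak s(\delta)=[X\xrightarrow{x}Y\xrightarrow{y}Z]$, such that the axioms (ET3), (ET3)$^{\mathrm{op}}$, (ET4) and (ET4)$^{\mathrm{op}}$ hold. (Two sequences $X\to Y\to Z$ and $X\to Y'\to Z$ are equivalent if there is an isomorphism $Y\cong Y'$ compatible with the identities of $X$ and $Z$.) Write $a_*\delta=\mathbb E(Z,a)(\delta)$ and $c^*\delta=\mathbb E(c,X)(\delta)$. Let $\tilde{\mathscr C}$ be the idempotent completion (Karoubi envelope) of $\mathscr C$: its objects are the pairs $(X,p)$ with $p\colon X\to X$, $p^2=p$; its morphisms $(X,p)\to(Y,q)$ are the morphisms $\sigma\colon X\to Y$ of $\mathscr C$ with $\sigma p=q\sigma=\sigma$; and $1_{(X,p)}=p$. Define $\mathbb F\colon\tilde{\mathscr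 C}^{\mathrm{op}}\times\tilde{\mathscr C}\to Ab$ on objects by the subgroup $$\mathbb F((Z,p),(X,q))=p^*q_*\mathbb E(Z,X)=\{p^*q_*\varepsilon\mid\varepsilon\in\mathbb E(Z,X)\}\subseteq\mathbb E(Z,X)$$ and on morphisms by $\mathbb F(\alpha,\beta)(\delta)=\beta_*\alpha^*\delta$. Then the following hold. 1. For every $\delta\in\mathbb F((Z,p),(X,q))$ and every representative $X\xrightarrow{x}Y\xrightarrow{y}Z$ of $\mathfrak s(\delta)$ there is an idempotent $r\colon Y\to Y$ with $rx=xq$ and $yr=py$, and the equivalence class $$\mathfrak r(\delta):=[(X,q)\xrightarrow{xq}(Y,r)\xrightarrow{py}(Z,p)]$$ in $\tilde{\mathscr C}$ depends neither on the choice of the representative nor on the choice of $r$. 2. $(\tilde{\mathscr C},\mathbb F,\mathfrak r)$ is an extriangulated category. 3. The embedding $i_{\mathscr C}\colon\mathscr C\to\tilde{\mathscr C}$, $X\mapsto(X,1_X)$, $f\mapsto f$, is an extriangulated functor: it is additive, and there is a natural transformation $\Gamma\colon\mathbb E\Rightarrow\mathbb F(i_{\mathscr C}^{\mathrm{op}}-,i_{\mathscr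 C}-)$ such that $\mathfrak s(\delta)=[X\xrightarrow{x}Y\xrightarrow{y}Z]$ implies $\mathfrak r(\Gamma(\delta))=[i_{\mathscr C}X\xrightarrow{i_{\mathscr C}x}i_{\mathscr C}Y\xrightarrow{i_{\mathscr C}y}i_{\mathscr C}Z]$. -/

import Mathlib

open CategoryTheory CategoryTheory.Limits CategoryTheory.Idempotents Opposite

universe w v u v' u'

namespace Extriangulated

section Defs

variable {C : Type u} [Category.{v} C]

/-- For a bifunctor `E : Cᵒᵖ × C → Ab` (written in curried form), the group `E(Z, X)` of
extensions of `Z` by `X`. -/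
abbrev ExtGroup (E : Cᵒᵖ ⥤ C ⥤ AddCommGrpCat.{w}) (Z X : C) : Type w := (E.obj (op Z)).obj X

/-- `a_* δ = E(Z, a)(δ)`. -/
def push (E : Cᵒᵖ ⥤ C ⥤ AddCommGrpCat.{w}) {Z X X' : C} (a : X ⟶ X') (δ : ExtGroup E Z X) :
    ExtGroup E Z X' :=
  ((E.obj (op Z)).map a).hom δ

/-- `c^* δ = E(c, X)(δ)`. -/
def pull (E : Cᵒᵖ ⥤ C ⥤ AddCommGrpCat.{w}) {Z Z' X : C} (c : Z' ⟶ Z) (δ : ExtGroup E Z X) :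
    ExtGroup E Z' X :=
  ((E.map c.op).app X).hom δ

/-- A sequence of morphisms `A --x--> B --y--> Z` with given end terms `A` and `Z`. -/
structure Seq (A Z : C) where
  /-- the middle term -/
  B : C
  /-- the first morphism -/
  x : A ⟶ B
  /-- the second morphism -/
  y : B ⟶ Z

/-- Two sequences with the same end terms are equivalent if there is an isomorphism of the middle
terms which, together with the identities of the end terms, gives a commutative diagram. -/
def Seq.Equivalent {A Z : C} (S T : Seq A Z) : Prop :=
  ∃ b : S.B ≅ T.B, S.x ≫ b.hom = T.x ∧ b.hom ≫ T.y = S.y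

instance Seq.setoid (A Z : C) : Setoid (Seq A Z) where
  r := Seq.Equivalent
  iseqv :=
    { refl := fun S => ⟨Iso.refl _, by simp, by simp⟩
      symm := by
        rintro S T ⟨b, h₁, h₂⟩
        exact ⟨b.symm, by simp [← h₁], by simp [← h₂]⟩
      trans := by
        rintro S T U ⟨b, h₁, h₂⟩ ⟨c, h₃, h₄⟩
        exact ⟨b ≪≫ c, by simp [← Category.assoc, h₁, h₃], by simp [h₄, h₂]⟩ }

/-- Equivalence classes of sequences `A ⟶ B ⟶ Z`. -/
abbrev SeqClass (A Z : C) := Quotient (Seq.setoid A Z)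

/-- The equivalence class `[A --x--> B --y--> Z]`. -/
def cls {A B Z : C} (x : A ⟶ B) (y : B ⟶ Z) : SeqClass A Z :=
  Quotient.mk (Seq.setoid A Z) ⟨B, x, y⟩

/-- A correspondence assigning to every extension `δ ∈ E(Z, A)` an equivalence class
`[A ⟶ B ⟶ Z]` of sequences. -/
abbrev Correspondence (E : Cᵒᵖ ⥤ C ⥤ AddCommGrpCat.{w}) :=
  ∀ ⦃Z A : C⦄, ExtGroup E Z A → SeqClass A Z

/-- `s` is a realisation of `E`: every morphism of extensions lifts to the middle terms, for all
representatives of the classes `s δ` and `s δ'`. -/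
def IsRealisation (E : Cᵒᵖ ⥤ C ⥤ AddCommGrpCat.{w}) (s : Correspondence E) : Prop :=
  ∀ ⦃A B Z A' B' Z' : C⦄ (δ : ExtGroup E Z A) (δ' : ExtGroup E Z' A')
    (x : A ⟶ B) (y : B ⟶ Z) (x' : A' ⟶ B') (y' : B' ⟶ Z'),
    s δ = cls x y → s δ' = cls x' y' →
    ∀ (a : A ⟶ A') (c : Z ⟶ Z'), push E a δ = pull E c δ' →
      ∃ b : B ⟶ B', x ≫ b = a ≫ x' ∧ b ≫ y' = y ≫ c

attribute [local instance] hasBinaryBiproducts_of_finite_biproducts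

variable [Preadditive C] [HasFiniteBiproducts C]

/-- The class `[A ⟶ A ⊞ Z ⟶ Z]` of the split sequence. -/
noncomputable def zeroCls (A Z : C) : SeqClass A Z :=
  cls (biprod.inl : A ⟶ A ⊞ Z) (biprod.snd : A ⊞ Z ⟶ Z)

/-- The direct sum of two equivalence classes of sequences. -/
noncomputable def sumCls {A Z A' Z' : C} (S : SeqClass A Z) (S' : SeqClass A' Z') :
    SeqClass (A ⊞ A') (Z ⊞ Z') :=
  Quotient.map₂
    (fun (T : Seq A Z) (T' : Seq A' Z') =>
      (⟨T.B ⊞ T'.B, biprod.map T.x T'.x, biprod.map T.y T'.y⟩ : Seq (A ⊞ A') (Z ⊞ Z')))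
    (by
      rintro S T ⟨b, h₁, h₂⟩ S' T' ⟨b', h₁', h₂'⟩
      refine ⟨biprod.mapIso b b', ?_, ?_⟩
      · ext <;> simp [← h₁, ← h₁']
      · ext <;> simp [← h₂, ← h₂']) S S'

/-- The direct sum `δ ⊕ δ' ∈ E(Z ⊞ Z', A ⊞ A')`: the element whose components in
`E(Z, A) ⊕ E(Z, A') ⊕ E(Z', A) ⊕ E(Z', A')` are `(δ, 0, 0, δ')`. -/
noncomputable def sumExt (E : Cᵒᵖ ⥤ C ⥤ AddCommGrpCat.{w}) {Z A Z' A' : C}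
    (δ : ExtGroup E Z A) (δ' : ExtGroup E Z' A') : ExtGroup E (Z ⊞ Z') (A ⊞ A') :=
  pull E (biprod.fst : Z ⊞ Z' ⟶ Z) (push E (biprod.inl : A ⟶ A ⊞ A') δ) +
    pull E (biprod.snd : Z ⊞ Z' ⟶ Z') (push E (biprod.inr : A' ⟶ A ⊞ A') δ')

/-- `(C, E, s)` is an extriangulated category (where `C` is an additive category). -/
structure IsExtriangulated (E : Cᵒᵖ ⥤ C ⥤ AddCommGrpCat.{w}) (s : Correspondence E) : Prop where
  /-- (ET1): `E` is additive in the second variable. -/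
  additive_right : ∀ Z : Cᵒᵖ, (E.obj Z).Additive
  /-- (ET1): `E` is additive in the first variable. -/
  additive_left : ∀ A : C, (E.flip.obj A).Additive
  /-- (ET2): `s` is a realisation. -/
  realisation : IsRealisation E s
  /-- (ET2): `s` is additive: it sends `0` to the split class. -/
  realisation_zero : ∀ Z A : C, s (0 : ExtGroup E Z A) = zeroCls A Z
  /-- (ET2): `s` is additive: it is compatible with direct sums. -/
  realisation_sum : ∀ ⦃Z A Z' A' : C⦄ (δ : ExtGroup E Z A) (δ' : ExtGroup E Z' A'),
    s (sumExt E δ δ') = sumCls (s δ) (s δ')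
  /-- (ET3) -/
  et3 : ∀ ⦃A B Z A' B' Z' : C⦄ (δ : ExtGroup E Z A) (δ' : ExtGroup E Z' A')
    (x : A ⟶ B) (y : B ⟶ Z) (x' : A' ⟶ B') (y' : B' ⟶ Z'),
    s δ = cls x y → s δ' = cls x' y' →
    ∀ (a : A ⟶ A') (b : B ⟶ B'), x ≫ b = a ≫ x' →
      ∃ c : Z ⟶ Z', push E a δ = pull E c δ' ∧ b ≫ y' = y ≫ c
  /-- (ET3)ᵒᵖ -/
  et3_op : ∀ ⦃A B Z A' B' Z' : C⦄ (δ : ExtGroup E Z A) (δ' : ExtGroup E Z' A')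
    (x : A ⟶ B) (y : B ⟶ Z) (x' : A' ⟶ B') (y' : B' ⟶ Z'),
    s δ = cls x y → s δ' = cls x' y' →
    ∀ (b : B ⟶ B') (c : Z ⟶ Z'), b ≫ y' = y ≫ c →
      ∃ a : A ⟶ A', push E a δ = pull E c δ' ∧ x ≫ b = a ≫ x'
  /-- (ET4) -/
  et4 : ∀ ⦃A B D K F : C⦄ (δ : ExtGroup E D A) (δ' : ExtGroup E F B)
    (f : A ⟶ B) (f' : B ⟶ D) (g : B ⟶ K) (g' : K ⟶ F),
    s δ = cls f f' → s δ' = cls g g' →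
    ∃ (L : C) (d : D ⟶ L) (e : L ⟶ F) (h : A ⟶ K) (h' : K ⟶ L) (δ'' : ExtGroup E L A),
      f ≫ g = h ∧ f' ≫ d = g ≫ h' ∧ h' ≫ e = g' ∧
      s δ'' = cls h h' ∧
      s (push E f' δ') = cls d e ∧
      pull E d δ'' = δ ∧
      push E f δ'' = pull E e δ'
  /-- (ET4)ᵒᵖ -/
  et4_op : ∀ ⦃D A B F K : C⦄ (δ : ExtGroup E B D) (δ' : ExtGroup E K F)
    (f' : D ⟶ A) (f : A ⟶ B) (g' : F ⟶ B) (g : B ⟶ K),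
    s δ = cls f' f → s δ' = cls g' g →
    ∃ (L : C) (d : D ⟶ L) (e : L ⟶ F) (h' : L ⟶ A) (h : A ⟶ K) (δ'' : ExtGroup E K L),
      f ≫ g = h ∧ h' ≫ f = e ≫ g' ∧ d ≫ h' = f' ∧
      s δ'' = cls h' h ∧
      s (pull E g' δ) = cls d e ∧
      push E e δ'' = δ' ∧
      pull E g δ'' = push E d δ

/-- An additive functor `G : C ⥤ D` is an extriangulated functor `(C, E, s) → (D, E', s')` if there
is a natural transformation `Γ : E ⟶ E'(G -, G -)` such that `s δ = [x, y]` implies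
`s' (Γ δ) = [G x, G y]`. -/
def IsExtriangulatedFunctor {D : Type u'} [Category.{v'} D] [Preadditive D]
    (E : Cᵒᵖ ⥤ C ⥤ AddCommGrpCat.{w}) (s : Correspondence E)
    (E' : Dᵒᵖ ⥤ D ⥤ AddCommGrpCat.{w}) (s' : Correspondence E') (G : C ⥤ D) : Prop :=
  G.Additive ∧
  ∃ Γ : E ⟶ G.op ⋙ E' ⋙ (Functor.whiskeringLeft C D AddCommGrpCat.{w}).obj G,
    ∀ ⦃A B Z : C⦄ (δ : ExtGroup E Z A) (x : A ⟶ B) (y : B ⟶ Z), s δ = cls x y →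
      s' (Z := G.obj Z) (A := G.obj A) (((Γ.app (op Z)).app A).hom δ) = cls (G.map x) (G.map y)

end Defs

section Karoubi

variable {C : Type u} [Category.{v} C]

/-- For objects `P = (Z, p)` and `Q = (X, q)` of the idempotent completion, the subgroup
`p^* q_* E(Z, X) = {p^* q_* ε | ε ∈ E(Z, X)}` of `E(Z, X)`. -/
def karoubiSubgroup (E : Cᵒᵖ ⥤ C ⥤ AddCommGrpCat.{w}) (P Q : Karoubi C) :
    AddSubgroup (ExtGroup E P.X Q.X) :=
  ((E.obj (op P.X)).map Q.p ≫ (E.map P.p.op).app Q.X).hom.range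

theorem mem_karoubiSubgroup (E : Cᵒᵖ ⥤ C ⥤ AddCommGrpCat.{w}) {P Q : Karoubi C}
    (δ : ExtGroup E P.X Q.X) :
    δ ∈ karoubiSubgroup E P Q ↔ ∃ ε : ExtGroup E P.X Q.X, pull E P.p (push E Q.p ε) = δ :=
  Iff.rfl

theorem push_push (E : Cᵒᵖ ⥤ C ⥤ AddCommGrpCat.{w}) {Z X X' X'' : C} (a : X ⟶ X') (b : X' ⟶ X'')
    (δ : ExtGroup E Z X) : push E b (push E a δ) = push E (a ≫ b) δ := by
  simp [push]

theorem pull_pull (E : Cᵒᵖ ⥤ C ⥤ AddCommGrpCat.{w}) {Z Z' Z'' X : C} (c : Z' ⟶ Z) (d : Z'' ⟶ Z')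
    (δ : ExtGroup E Z X) : pull E d (pull E c δ) = pull E (d ≫ c) δ := by
  simp [pull]

theorem push_pull (E : Cᵒᵖ ⥤ C ⥤ AddCommGrpCat.{w}) {Z Z' X X' : C} (a : X ⟶ X') (c : Z' ⟶ Z)
    (δ : ExtGroup E Z X) : push E a (pull E c δ) = pull E c (push E a δ) :=
  (ConcreteCategory.congr_hom ((E.map c.op).naturality a) δ).symm

theorem push_mem (E : Cᵒᵖ ⥤ C ⥤ AddCommGrpCat.{w}) {P Q Q' : Karoubi C} (f : Q ⟶ Q')
    (δ : ExtGroup E P.X Q.X) (h : δ ∈ karoubiSubgroup E P Q) :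
    push E f.f δ ∈ karoubiSubgroup E P Q' := by
  obtain ⟨ε, rfl⟩ := (mem_karoubiSubgroup E δ).1 h
  exact (mem_karoubiSubgroup E _).2 ⟨push E f.f ε, by
    rw [push_pull, push_push, push_push, Karoubi.p_comp, Karoubi.comp_p]⟩

theorem pull_mem (E : Cᵒᵖ ⥤ C ⥤ AddCommGrpCat.{w}) {P P' Q : Karoubi C} (f : P' ⟶ P)
    (δ : ExtGroup E P.X Q.X) (h : δ ∈ karoubiSubgroup E P Q) :
    pull E f.f δ ∈ karoubiSubgroup E P' Q := by
  obtain ⟨ε, rfl⟩ := (mem_karoubiSubgroup E δ).1 h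
  exact (mem_karoubiSubgroup E _).2 ⟨pull E f.f ε, by
    rw [push_pull, pull_pull, pull_pull, Karoubi.p_comp, Karoubi.comp_p]⟩

theorem push_p (E : Cᵒᵖ ⥤ C ⥤ AddCommGrpCat.{w}) {P Q : Karoubi C}
    (δ : ExtGroup E P.X Q.X) (h : δ ∈ karoubiSubgroup E P Q) : push E Q.p δ = δ := by
  obtain ⟨ε, rfl⟩ := (mem_karoubiSubgroup E δ).1 h
  rw [push_pull, push_push, Q.idem]

theorem pull_p (E : Cᵒᵖ ⥤ C ⥤ AddCommGrpCat.{w}) {P Q : Karoubi C}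
    (δ : ExtGroup E P.X Q.X) (h : δ ∈ karoubiSubgroup E P Q) : pull E P.p δ = δ := by
  obtain ⟨ε, rfl⟩ := (mem_karoubiSubgroup E δ).1 h
  rw [pull_pull, P.idem]

/-- The bifunctor on the idempotent completion given on objects by
`((Z, p), (X, q)) ↦ p^* q_* E(Z, X)` and on morphisms by `(α, β) ↦ (ε ↦ β_* α^* ε)`. -/
def karoubiExt (E : Cᵒᵖ ⥤ C ⥤ AddCommGrpCat.{w}) :
    (Karoubi C)ᵒᵖ ⥤ Karoubi C ⥤ AddCommGrpCat.{w} where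
  obj P :=
    { obj := fun Q => AddCommGrpCat.of (karoubiSubgroup E P.unop Q)
      map := fun {Q Q'} f => AddCommGrpCat.ofHom
        (((((E.obj (op P.unop.X)).map f.f).hom).comp
          (karoubiSubgroup E P.unop Q).subtype).codRestrict (karoubiSubgroup E P.unop Q')
          (fun δ => push_mem E f δ.1 δ.2))
      map_id := fun Q => by
        ext δ
        exact push_p E δ.1 δ.2
      map_comp := fun {Q Q' Q''} f g => by
        ext δ
        exact (push_push E f.f g.f δ.1).symm }
  map {P P'} c :=
    { app := fun Q => AddCommGrpCat.ofHom
        (((((E.map c.unop.f.op).app Q.X).hom).comp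
          (karoubiSubgroup E P.unop Q).subtype).codRestrict (karoubiSubgroup E P'.unop Q)
          (fun δ => pull_mem E c.unop δ.1 δ.2))
      naturality := fun Q Q' f => by
        ext δ
        exact (push_pull E f.f c.unop.f δ.1).symm }
  map_id P := by
    ext Q δ
    exact pull_p E δ.1 δ.2
  map_comp {P P' P''} c d := by
    ext Q δ
    exact (pull_pull E c.unop.f d.unop.f δ.1).symm

/-- The inclusion of `p^* q_* E(Z, X)` into `E(Z, X)`. -/
def karoubiVal (E : Cᵒᵖ ⥤ C ⥤ AddCommGrpCat.{w}) {P Q : Karoubi C}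
    (δ : ExtGroup (karoubiExt E) P Q) : ExtGroup E P.X Q.X :=
  (karoubiSubgroup E P Q).subtype δ

/-- For objects `P = (Z, p)`, `Q = (X, q)` of the idempotent completion and a sequence
`X --x--> Y --y--> Z`, the endomorphism `r` of `Y` is an idempotent lifting the pair `(q, p)`:
`r² = r`, `r x = x q` and `y r = p y`. -/
structure IsIdempotentLift (P Q : Karoubi C) {Y : C} (x : Q.X ⟶ Y) (y : Y ⟶ P.X) (r : Y ⟶ Y) :
    Prop where
  idem : r ≫ r = r
  left : x ≫ r = Q.p ≫ x
  right : r ≫ y = y ≫ P.p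

/-- The class of the sequence `(X, q) --xq--> (Y, r) --py--> (Z, p)` in the idempotent
completion. -/
def karoubiCls (P Q : Karoubi C) {Y : C} (x : Q.X ⟶ Y) (y : Y ⟶ P.X) (r : Y ⟶ Y)
    (hr : IsIdempotentLift P Q x y r) : SeqClass Q P :=
  cls (A := Q) (B := Karoubi.mk Y r hr.idem) (Z := P)
    (Karoubi.Hom.mk (Q.p ≫ x) (by
      simp only [Category.assoc, hr.left, Karoubi.idem_assoc]))
    (Karoubi.Hom.mk (y ≫ P.p) (by
      rw [Category.assoc, P.idem, ← Category.assoc, hr.right, Category.assoc, P.idem]))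

end Karoubi

end Extriangulated

open Extriangulated

namespace Extriangulated

attribute [local instance] hasBinaryBiproducts_of_finite_biproducts

/-! ### Calculus of extensions for a biadditive bifunctor. -/

section Bifunctor

variable {C : Type u} [Category.{v} C] (E : Cᵒᵖ ⥤ C ⥤ AddCommGrpCat.{w})

/-! Everything in the completion is a direct factor of something in `C`. An extension `δ` lies in
`F((Z, p), (X, q))` exactly when `p` and `q` fix it, so `(q, p)` is an endomorphism of `δ` and lifts
to some `b` on the middle term. The error `b² - b` has square zero, by weak exactness, so `b` can be
corrected to an idempotent `3b² - 2b³`, as when lifting idempotents modulo a nil ideal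
(`exists_isIdempotentLift`). Independence of all choices rests on one principle,
`cls_eq_of_weakExact`: comparison maps in both directions over the identities of the ends force
equivalence.

Weak exactness passes to direct factors (`WeakExact.karoubi`). The same principle then gives
compatibility of the new realisation with direct sums and with isomorphisms of the end terms. The
lifting axiom, (ET3) and its dual descend by conjugating with the inclusion and projection of the
factor (`IsDirectFactor`).

The hard axiom is (ET4). Its octahedron in `C` must carry idempotents making all maps compatible,
and idempotents lifted separately on the two new objects need not commute with the map between them.
Instead (`exists_octahedron_idempotents` and its dual) one describes the complements: `1 - p` and `1
- q` annihilate the extensions, so the complementary parts split, and their splittings can be chosen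
coherently. The required idempotents are the identity minus two orthogonal idempotents built from
these splittings. -/

theorem push_id {Z X : C} (δ : ExtGroup E Z X) : push E (𝟙 X) δ = δ := by
  simp [push]

theorem pull_id {Z X : C} (δ : ExtGroup E Z X) : pull E (𝟙 Z) δ = δ := by
  simp [pull]

theorem push_zero {Z X X' : C} (a : X ⟶ X') : push E a (0 : ExtGroup E Z X) = 0 :=
  map_zero _

theorem pull_zero {Z Z' X : C} (c : Z' ⟶ Z) : pull E c (0 : ExtGroup E Z X) = 0 :=
  map_zero _

theorem push_add {Z X X' : C} (a : X ⟶ X') (δ ε : ExtGroup E Z X) :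
    push E a (δ + ε) = push E a δ + push E a ε :=
  map_add _ _ _

theorem pull_add {Z Z' X : C} (c : Z' ⟶ Z) (δ ε : ExtGroup E Z X) :
    pull E c (δ + ε) = pull E c δ + pull E c ε :=
  map_add _ _ _

theorem cls_eq_iff {A B B' Z : C} (x : A ⟶ B) (y : B ⟶ Z) (x' : A ⟶ B') (y' : B' ⟶ Z) :
    cls x y = cls x' y' ↔ ∃ b : B ≅ B', x ≫ b.hom = x' ∧ b.hom ≫ y' = y :=
  Quotient.eq

theorem exists_rep {A Z : C} (S : SeqClass A Z) :
    ∃ (B : C) (x : A ⟶ B) (y : B ⟶ Z), S = cls x y := by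
  induction S using Quotient.inductionOn with
  | h S => exact ⟨S.B, S.x, S.y, rfl⟩

variable [Preadditive C]

/-- `E` is additive in both variables. -/
structure IsBiadditive : Prop where
  right : ∀ Z : Cᵒᵖ, (E.obj Z).Additive
  left : ∀ A : C, (E.flip.obj A).Additive

variable {E}

namespace IsBiadditive

theorem add_push (hE : IsBiadditive E) {Z X X' : C} (a b : X ⟶ X') (δ : ExtGroup E Z X) :
    push E (a + b) δ = push E a δ + push E b δ := by
  have := (hE.right (op Z)).map_add (f := a) (g := b)
  simp only [push, this]
  rfl

theorem add_pull (hE : IsBiadditive E) {Z Z' X : C} (a b : Z' ⟶ Z) (δ : ExtGroup E Z X) :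
    pull E (a + b) δ = pull E a δ + pull E b δ := by
  have := (hE.left X).map_add (f := a.op) (g := b.op)
  simp only [Functor.flip_obj_map] at this
  simp only [pull, op_add, this]
  rfl

theorem zero_push (hE : IsBiadditive E) {Z X X' : C} (δ : ExtGroup E Z X) :
    push E (0 : X ⟶ X') δ = 0 := by
  have := hE.add_push (0 : X ⟶ X') 0 δ
  simpa using this

theorem zero_pull (hE : IsBiadditive E) {Z Z' X : C} (δ : ExtGroup E Z X) :
    pull E (0 : Z' ⟶ Z) δ = 0 := by
  have := hE.add_pull (0 : Z' ⟶ Z) 0 δ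
  simpa using this

theorem sub_push (hE : IsBiadditive E) {Z X X' : C} (a b : X ⟶ X') (δ : ExtGroup E Z X) :
    push E (a - b) δ = push E a δ - push E b δ := by
  rw [eq_sub_iff_add_eq, ← hE.add_push, sub_add_cancel]

theorem sub_pull (hE : IsBiadditive E) {Z Z' X : C} (a b : Z' ⟶ Z) (δ : ExtGroup E Z X) :
    pull E (a - b) δ = pull E a δ - pull E b δ := by
  rw [eq_sub_iff_add_eq, ← hE.add_pull, sub_add_cancel]

end IsBiadditive

end Bifunctor

/-! ### Weak exactness of realised sequences and uniqueness of the middle term. -/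

section Exactness

open ZeroObject

theorem isIso_of_isIso_comp {C : Type u} [Category.{v} C] {X Y : C} (f : X ⟶ Y)
    (g : Y ⟶ X) [IsIso (f ≫ g)] [IsIso (g ≫ f)] :
    IsIso f := by
  refine ⟨g ≫ inv (f ≫ g), ?_, ?_⟩
  · rw [← Category.assoc, IsIso.hom_inv_id]
  · have h₁ : f ≫ g ≫ inv (f ≫ g) = 𝟙 _ := by rw [← Category.assoc, IsIso.hom_inv_id]
    have h₂ : (inv (g ≫ f) ≫ g) ≫ f = 𝟙 _ := by rw [Category.assoc, IsIso.inv_hom_id]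
    have h₃ : g ≫ inv (f ≫ g) = inv (g ≫ f) ≫ g := by
      rw [← Category.id_comp (g ≫ inv (f ≫ g)), ← h₂, Category.assoc, h₁, Category.comp_id]
    rw [h₃, h₂]

variable {C : Type u} [Category.{v} C] [Preadditive C]

/-- `A --x--> B --y--> Z` composes to zero, and `y` is a weak cokernel of `x`. -/
structure WeakExact {A B Z : C} (x : A ⟶ B) (y : B ⟶ Z) : Prop where
  zero : x ≫ y = 0
  desc : ∀ ⦃T : C⦄ (f : B ⟶ T), x ≫ f = 0 → ∃ c : Z ⟶ T, f = y ≫ c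

/-- As `b - 1` kills `x`, it factors through `y`; as it is also killed by `y`, its square is zero.
Hence `2 - b` is inverse to `b`. Only the weak cokernel half of exactness is needed. -/
theorem WeakExact.isIso {A B Z : C} {x : A ⟶ B} {y : B ⟶ Z} (h : WeakExact x y)
    (b : B ⟶ B) (hx : x ≫ b = x) (hy : b ≫ y = y) : IsIso b := by
  obtain ⟨c, hc⟩ := h.desc (b - 𝟙 B) (by simp [hx])
  have hn : (b - 𝟙 B) ≫ (b - 𝟙 B) = 0 := by
    nth_rw 2 [hc]
    rw [← Category.assoc, Preadditive.sub_comp, hy]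
    simp
  have hb : b ≫ b = b + b - 𝟙 B := by
    simp only [Preadditive.sub_comp, Preadditive.comp_sub, Category.comp_id,
      Category.id_comp] at hn
    rw [← sub_eq_zero, ← hn]; abel
  exact ⟨𝟙 B + 𝟙 B - b, by simp [hb], by simp [hb]⟩

theorem WeakExact.of_iso {A A' B Z : C} {x : A ⟶ B} {y : B ⟶ Z} (h : WeakExact x y)
    (a : A' ≅ A) : WeakExact (a.hom ≫ x) y where
  zero := by simp [h.zero]
  desc T f hf := h.desc f (by simpa using hf)

/-- Two weakly exact sequences with morphisms in both directions which are the identity on the end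
terms are equivalent. -/
theorem cls_eq_of_weakExact {A B B' Z : C} {x : A ⟶ B} {y : B ⟶ Z} {x' : A ⟶ B'} {y' : B' ⟶ Z}
    (h : WeakExact x y) (h' : WeakExact x' y') (b : B ⟶ B') (b' : B' ⟶ B)
    (h₁ : x ≫ b = x') (h₂ : b ≫ y' = y) (h₃ : x' ≫ b' = x) (h₄ : b' ≫ y = y') :
    cls x y = cls x' y' := by
  have := h.isIso (b ≫ b') (by rw [← Category.assoc, h₁, h₃]) (by rw [Category.assoc, h₄, h₂])
  have := h'.isIso (b' ≫ b) (by rw [← Category.assoc, h₃, h₁]) (by rw [Category.assoc, h₂, h₄])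
  have := isIso_of_isIso_comp b b'
  exact (cls_eq_iff _ _ _ _).2 ⟨asIso b, h₁, h₂⟩

variable {E : Cᵒᵖ ⥤ C ⥤ AddCommGrpCat.{w}} {s : Correspondence E}

/-- A realisation with weakly exact classes is compatible with isomorphisms of the first term. -/
theorem realisation_push_iso (hr : IsRealisation E s)
    (hw : ∀ ⦃A B Z : C⦄ (δ : ExtGroup E Z A) (x : A ⟶ B) (y : B ⟶ Z), s δ = cls x y →
      WeakExact x y)
    {A A' B Z : C} (δ : ExtGroup E Z A) (x : A ⟶ B) (y : B ⟶ Z) (h : s δ = cls x y)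
    (a : A ≅ A') : s (push E a.hom δ) = cls (a.inv ≫ x) y := by
  obtain ⟨B', x', y', h'⟩ := exists_rep (s (push E a.hom δ))
  obtain ⟨b, h₁, h₂⟩ := hr δ _ x y x' y' h h' a.hom (𝟙 _) (by rw [pull_id])
  obtain ⟨b', h₃, h₄⟩ := hr _ δ x' y' x y h' h a.inv (𝟙 _)
    (by rw [pull_id, push_push, a.hom_inv_id, push_id])
  rw [h']
  exact cls_eq_of_weakExact (hw _ _ _ h') ((hw _ _ _ h).of_iso a.symm) b' b h₃
    (by simpa using h₄) (by simp [h₁]) (by simpa using h₂)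

theorem WeakExact.of_iso_right {A B Z Z' : C} {x : A ⟶ B} {y : B ⟶ Z} (h : WeakExact x y)
    (c : Z ≅ Z') : WeakExact x (y ≫ c.hom) where
  zero := by simp [reassoc_of% h.zero]
  desc T f hf := by
    obtain ⟨d, rfl⟩ := h.desc f hf
    exact ⟨c.inv ≫ d, by simp⟩

/-- A realisation with weakly exact classes is compatible with isomorphisms of the last term. -/
theorem realisation_pull_iso (hr : IsRealisation E s)
    (hw : ∀ ⦃A B Z : C⦄ (δ : ExtGroup E Z A) (x : A ⟶ B) (y : B ⟶ Z), s δ = cls x y →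
      WeakExact x y)
    {A B Z Z' : C} (δ : ExtGroup E Z A) (x : A ⟶ B) (y : B ⟶ Z) (h : s δ = cls x y)
    (c : Z' ≅ Z) : s (pull E c.hom δ) = cls x (y ≫ c.inv) := by
  obtain ⟨B', x', y', h'⟩ := exists_rep (s (pull E c.hom δ))
  obtain ⟨b, h₁, h₂⟩ := hr δ _ x y x' y' h h' (𝟙 _) c.inv
    (by rw [pull_pull, c.inv_hom_id, pull_id, push_id])
  obtain ⟨b', h₃, h₄⟩ := hr _ δ x' y' x y h' h (𝟙 _) c.hom (by rw [push_id])
  rw [h']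
  exact cls_eq_of_weakExact (hw _ _ _ h') ((hw _ _ _ h).of_iso_right c.symm) b' b
    (by simpa using h₃) (by simp [reassoc_of% h₄]) (by simpa using h₁) h₂

variable [HasFiniteBiproducts C]

theorem WeakExact.biprod_map {A B Z A' B' Z' : C} {x : A ⟶ B} {y : B ⟶ Z} {x' : A' ⟶ B'}
    {y' : B' ⟶ Z'} (h : WeakExact x y) (h' : WeakExact x' y') :
    WeakExact (biprod.map x x') (biprod.map y y') where
  zero := by ext <;> simp [reassoc_of% h.zero, reassoc_of% h'.zero]
  desc T f hf := by
    obtain ⟨c, hc⟩ := h.desc (biprod.inl ≫ f) (by simpa using biprod.inl ≫= hf)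
    obtain ⟨c', hc'⟩ := h'.desc (biprod.inr ≫ f) (by simpa using biprod.inr ≫= hf)
    exact ⟨biprod.desc c c', by ext <;> simp [hc, hc']⟩

/-- A realisation with weakly exact classes of a biadditive functor is compatible with direct
sums. -/
theorem realisation_sum_of_weakExact (hE : IsBiadditive E) (hr : IsRealisation E s)
    (hw : ∀ ⦃A B Z : C⦄ (δ : ExtGroup E Z A) (x : A ⟶ B) (y : B ⟶ Z), s δ = cls x y →
      WeakExact x y)
    {Z A Z' A' : C} (δ : ExtGroup E Z A) (δ' : ExtGroup E Z' A') :
    s (sumExt E δ δ') = sumCls (s δ) (s δ') := by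
  obtain ⟨B, x, y, h⟩ := exists_rep (s δ)
  obtain ⟨B', x', y', h'⟩ := exists_rep (s δ')
  obtain ⟨M, m, n, hm⟩ := exists_rep (s (sumExt E δ δ'))
  -- By biadditivity the inclusions and projections of the end terms are morphisms of extensions
  -- between `δ`, `δ'` and `δ ⊕ δ'`. Their lifts assemble to comparison maps in both directions.
  obtain ⟨b, hb₁, hb₂⟩ := hr _ _ x y m n h hm biprod.inl biprod.inl (by
    simp [sumExt, pull_add, pull_pull, pull_id, hE.zero_pull])
  obtain ⟨b', hb₁', hb₂'⟩ := hr _ _ x' y' m n h' hm biprod.inr biprod.inr (by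
    simp [sumExt, pull_add, pull_pull, pull_id, hE.zero_pull])
  obtain ⟨c, hc₁, hc₂⟩ := hr _ _ m n x y hm h biprod.fst biprod.fst (by
    simp [sumExt, push_add, push_pull, push_push, push_id, hE.zero_push, pull_zero])
  obtain ⟨c', hc₁', hc₂'⟩ := hr _ _ m n x' y' hm h' biprod.snd biprod.snd (by
    simp [sumExt, push_add, push_pull, push_push, push_id, hE.zero_push, pull_zero])
  have hsum : sumCls (s δ) (s δ') = cls (biprod.map x x') (biprod.map y y') := by
    rw [h, h']; rfl
  rw [hsum, hm]
  refine cls_eq_of_weakExact (hw _ _ _ hm) ((hw _ _ _ h).biprod_map (hw _ _ _ h'))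
    (biprod.lift c c') (biprod.desc b b') ?_ ?_ ?_ ?_
  · apply biprod.hom_ext <;> simp [hc₁, hc₁']
  · apply biprod.hom_ext <;> simp [hc₂, hc₂']
  · apply biprod.hom_ext' <;> simp [hb₁, hb₁']
  · apply biprod.hom_ext' <;> simp [hb₂, hb₂']

namespace IsExtriangulated

variable (hs : IsExtriangulated E s)
include hs

theorem isBiadditive : IsBiadditive E := ⟨hs.additive_right, hs.additive_left⟩

variable {A B Z : C} {δ : ExtGroup E Z A} {x : A ⟶ B} {y : B ⟶ Z}

/-- This and the following exactness statements come from comparing `δ` with a split sequence having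
a zero end term: such a sequence has its middle term isomorphic to its other end, so one of the two
comparison squares is vacuous and the other is the claim. -/
theorem comp_eq_zero (h : s δ = cls x y) : x ≫ y = 0 := by
  obtain ⟨c, -, hc⟩ := hs.et3 (0 : ExtGroup E (0 : C) A) δ biprod.inl biprod.snd x y
    (hs.realisation_zero _ _) h (𝟙 A) (biprod.fst ≫ x) (by simp)
  simpa using biprod.inl ≫= hc

theorem exists_desc (h : s δ = cls x y) {T : C} (f : B ⟶ T) (hf : x ≫ f = 0) :
    ∃ c : Z ⟶ T, f = y ≫ c := by
  obtain ⟨c, -, hc⟩ := hs.et3 δ (0 : ExtGroup E T (0 : C)) x y biprod.inl biprod.snd h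
    (hs.realisation_zero _ _) 0 (f ≫ biprod.inr) (by simp [reassoc_of% hf])
  exact ⟨c, by simpa using hc⟩

theorem exists_lift (h : s δ = cls x y) {T : C} (f : T ⟶ B) (hf : f ≫ y = 0) :
    ∃ a : T ⟶ A, f = a ≫ x := by
  obtain ⟨a, -, ha⟩ := hs.et3_op (0 : ExtGroup E (0 : C) T) δ biprod.inl biprod.snd x y
    (hs.realisation_zero _ _) h (biprod.fst ≫ f) 0 (by simp [hf])
  exact ⟨a, by simpa using ha⟩

theorem weakExact (h : s δ = cls x y) : WeakExact x y :=
  ⟨hs.comp_eq_zero h, fun _ f hf => hs.exists_desc h f hf⟩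

theorem exists_extension (h : s δ = cls x y) {T : C} (a : A ⟶ T) (ha : push E a δ = 0) :
    ∃ b : B ⟶ T, x ≫ b = a := by
  obtain ⟨b, hb, -⟩ := hs.realisation δ (0 : ExtGroup E (0 : C) T) x y biprod.inl biprod.snd h
    (hs.realisation_zero _ _) a 0 (by rw [ha, pull_zero])
  exact ⟨b ≫ biprod.fst, by simp [reassoc_of% hb]⟩

theorem exists_lifting (h : s δ = cls x y) {T : C} (c : T ⟶ Z) (hc : pull E c δ = 0) :
    ∃ b : T ⟶ B, b ≫ y = c := by
  obtain ⟨b, -, hb⟩ := hs.realisation (0 : ExtGroup E T (0 : C)) δ biprod.inl biprod.snd x y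
    (hs.realisation_zero _ _) h 0 c (by rw [hc, push_zero])
  exact ⟨biprod.inr ≫ b, by simp [hb]⟩

theorem push_eq_zero (h : s δ = cls x y) : push E x δ = 0 := by
  obtain ⟨c, hc, -⟩ := hs.et3 δ (0 : ExtGroup E (0 : C) B) x y biprod.inl biprod.snd h
    (hs.realisation_zero _ _) x biprod.inl rfl
  rw [hc, pull_zero]

theorem pull_eq_zero (h : s δ = cls x y) : pull E y δ = 0 := by
  obtain ⟨a, ha, -⟩ := hs.et3_op (0 : ExtGroup E B (0 : C)) δ biprod.inl biprod.snd x y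
    (hs.realisation_zero _ _) h biprod.snd y rfl
  rw [← ha, push_zero]

end IsExtriangulated

end Exactness

/-! ### The realisation of the completion, with every axiom except (ET4) and its dual. -/

section KaroubiRealisation

variable {C : Type u} [Category.{v} C] {E : Cᵒᵖ ⥤ C ⥤ AddCommGrpCat.{w}}

theorem karoubiVal_push {P Q Q' : Karoubi C} (f : Q ⟶ Q') (δ : ExtGroup (karoubiExt E) P Q) :
    karoubiVal E (push (karoubiExt E) f δ) = push E f.f (karoubiVal E δ) := rfl

theorem karoubiVal_pull {P P' Q : Karoubi C} (f : P' ⟶ P) (δ : ExtGroup (karoubiExt E) P Q) :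
    karoubiVal E (pull (karoubiExt E) f δ) = pull E f.f (karoubiVal E δ) := rfl

theorem karoubiVal_injective {P Q : Karoubi C} {δ δ' : ExtGroup (karoubiExt E) P Q}
    (h : karoubiVal E δ = karoubiVal E δ') : δ = δ' := Subtype.ext h

theorem push_karoubiVal {P Q : Karoubi C} (δ : ExtGroup (karoubiExt E) P Q) :
    push E Q.p (karoubiVal E δ) = karoubiVal E δ := push_p E _ δ.2

theorem pull_karoubiVal {P Q : Karoubi C} (δ : ExtGroup (karoubiExt E) P Q) :
    pull E P.p (karoubiVal E δ) = karoubiVal E δ := pull_p E _ δ.2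

/-- An extension fixed by the idempotents, as an extension in the idempotent completion. -/
def karoubiMk {P Q : Karoubi C} (δ : ExtGroup E P.X Q.X) (hQ : push E Q.p δ = δ)
    (hP : pull E P.p δ = δ) : ExtGroup (karoubiExt E) P Q :=
  (⟨δ, (mem_karoubiSubgroup E δ).2 ⟨δ, by rw [hQ, hP]⟩⟩ : karoubiSubgroup E P Q)

theorem karoubiVal_mk {P Q : Karoubi C} (δ : ExtGroup E P.X Q.X) (hQ : push E Q.p δ = δ)
    (hP : pull E P.p δ = δ) : karoubiVal E (karoubiMk δ hQ hP) = δ := rfl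

/-- The sequence `x, y` in the idempotent completion is exhibited, by means of `i` and `j`, as the
direct factor of the sequence `x₀, y₀` cut out by the idempotents of its end terms. -/
structure IsDirectFactor {P Q M : Karoubi C} {Y : C} (x₀ : Q.X ⟶ Y) (y₀ : Y ⟶ P.X) (i : Y ⟶ M.X)
    (j : M.X ⟶ Y) (x : Q ⟶ M) (y : M ⟶ P) : Prop where
  ji : j ≫ i = M.p
  ip : i ≫ M.p = i
  pj : M.p ≫ j = j
  xi : x₀ ≫ i = x.f
  xj : x.f ≫ j = Q.p ≫ x₀
  jy : j ≫ y₀ = y.f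
  iy : i ≫ y.f = y₀ ≫ P.p

theorem IsDirectFactor.comp_idem {P Q M : Karoubi C} {Y : C} {x₀ : Q.X ⟶ Y}
    {y₀ : Y ⟶ P.X} {i : Y ⟶ M.X} {j : M.X ⟶ Y} {x : Q ⟶ M} {y : M ⟶ P}
    (h : IsDirectFactor x₀ y₀ i j x y) : j ≫ i ≫ j = j := by
  rw [reassoc_of% h.ji, h.pj]

theorem IsDirectFactor.idem_comp {P Q M : Karoubi C} {Y : C} {x₀ : Q.X ⟶ Y}
    {y₀ : Y ⟶ P.X} {i : Y ⟶ M.X} {j : M.X ⟶ Y} {x : Q ⟶ M} {y : M ⟶ P}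
    (h : IsDirectFactor x₀ y₀ i j x y) : i ≫ j ≫ i = i := by
  rw [h.ji, h.ip]

theorem IsDirectFactor.isIdempotentLift {P Q M : Karoubi C} {Y : C} {x₀ : Q.X ⟶ Y}
    {y₀ : Y ⟶ P.X} {i : Y ⟶ M.X} {j : M.X ⟶ Y} {x : Q ⟶ M} {y : M ⟶ P}
    (h : IsDirectFactor x₀ y₀ i j x y) : IsIdempotentLift P Q x₀ y₀ (i ≫ j) where
  idem := by rw [Category.assoc, reassoc_of% h.ji, h.pj]
  left := by rw [reassoc_of% h.xi, h.xj]
  right := by rw [Category.assoc, h.jy, h.iy]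

theorem IsDirectFactor.karoubiCls_eq {P Q M : Karoubi C} {Y : C} {x₀ : Q.X ⟶ Y}
    {y₀ : Y ⟶ P.X} {i : Y ⟶ M.X} {j : M.X ⟶ Y} {x : Q ⟶ M} {y : M ⟶ P}
    (h : IsDirectFactor x₀ y₀ i j x y) :
    karoubiCls P Q x₀ y₀ (i ≫ j) h.isIdempotentLift = cls x y := by
  refine (cls_eq_iff _ _ _ _).2 ⟨⟨⟨i, ?_⟩, ⟨j, ?_⟩, ?_, ?_⟩, ?_, ?_⟩
  · simp [h.ip, h.ji]
  · simp [reassoc_of% h.ji, h.pj]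
  · ext; simp
  · ext; simp [h.ji]
  · ext; simp [h.xi]
  · ext; simp [h.iy]

/-- The axioms quantify over all representatives, whose middle term `M` is only isomorphic to `(Y,
r)`. Unpacking that isomorphism reduces them to equations in `C`. -/
theorem exists_isDirectFactor {P Q M : Karoubi C} {Y : C} {x₀ : Q.X ⟶ Y} {y₀ : Y ⟶ P.X}
    {r : Y ⟶ Y} (hr : IsIdempotentLift P Q x₀ y₀ r) {x : Q ⟶ M} {y : M ⟶ P}
    (h : karoubiCls P Q x₀ y₀ r hr = cls x y) :
    ∃ (i : Y ⟶ M.X) (j : M.X ⟶ Y), IsDirectFactor x₀ y₀ i j x y ∧ i ≫ j = r := by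
  obtain ⟨b, rfl, hy⟩ := (cls_eq_iff _ _ _ _).1 h
  rw [← Iso.eq_inv_comp] at hy
  subst hy
  have h₁ := congrArg Karoubi.Hom.f b.hom_inv_id
  have h₂ := congrArg Karoubi.Hom.f b.inv_hom_id
  have h₃ := Karoubi.p_comp b.hom
  have h₄ := Karoubi.comp_p b.inv
  simp only [Karoubi.comp_f, Karoubi.id_f] at h₁ h₂ h₃ h₄
  refine ⟨b.hom.f, b.inv.f, ⟨h₂, by simp, by simp, ?_, ?_, ?_, ?_⟩, h₁⟩
  · simp only [Karoubi.comp_f]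
    rw [← hr.left, Category.assoc, h₃]
  · simp only [Karoubi.comp_f, Category.assoc, h₁]
    rw [hr.left, Karoubi.idem_assoc]
  · simp only [Karoubi.comp_f]
    rw [← hr.right, reassoc_of% h₄]
  · simp only [Karoubi.comp_f]
    rw [reassoc_of% h₁, reassoc_of% hr.right, P.idem]

variable [Preadditive C]

theorem WeakExact.karoubi {P Q : Karoubi C} {Y : C} {x : Q.X ⟶ Y} {y : Y ⟶ P.X} {r : Y ⟶ Y}
    (hr : IsIdempotentLift P Q x y r) (h : WeakExact x y) {M : Karoubi C} {x' : Q ⟶ M} {y' : M ⟶ P}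
    (e : karoubiCls P Q x y r hr = cls x' y') : WeakExact x' y' := by
  obtain ⟨i, j, hij, -⟩ := exists_isDirectFactor hr e
  refine ⟨?_, fun T f hf => ?_⟩
  · ext
    simp only [Karoubi.comp_f, ← hij.xi, Category.assoc, hij.iy]
    simp [reassoc_of% h.zero]
  · obtain ⟨c, hc⟩ := h.desc (i ≫ f.f) (by
      rw [reassoc_of% hij.xi]; exact congrArg Karoubi.Hom.f hf)
    refine ⟨⟨P.p ≫ c ≫ T.p, by simp⟩, ?_⟩
    ext
    simp only [Karoubi.comp_f, Karoubi.comp_p_assoc]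
    rw [← hij.jy, Category.assoc, ← reassoc_of% hc, reassoc_of% hij.ji]
    simp

theorem karoubiExt_isBiadditive (hE : IsBiadditive E) : IsBiadditive (karoubiExt E) where
  right P := ⟨fun {Q Q' f g} => by
    ext δ
    exact Subtype.ext (hE.add_push f.f g.f δ.1)⟩
  left Q := ⟨fun {P P' f g} => by
    ext δ
    exact Subtype.ext (hE.add_pull f.unop.f g.unop.f δ.1)⟩

variable [HasFiniteBiproducts C] {s : Correspondence E}

namespace IsExtriangulated

variable (hs : IsExtriangulated E s)
include hs

theorem exists_isIdempotentLift {P Q : Karoubi C} {δ : ExtGroup E P.X Q.X}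
    (hQ : push E Q.p δ = δ) (hP : pull E P.p δ = δ) {Y : C} {x : Q.X ⟶ Y} {y : Y ⟶ P.X}
    (h : s δ = cls x y) : ∃ r : Y ⟶ Y, IsIdempotentLift P Q x y r := by
  obtain ⟨b, h₁, h₂⟩ := hs.realisation δ δ x y x y h h Q.p P.p (by rw [hQ, hP])
  have h₃ : x ≫ (b ≫ b - b) = 0 := by
    simp [reassoc_of% h₁, h₁]
  have h₄ : (b ≫ b - b) ≫ y = 0 := by
    simp [reassoc_of% h₂, h₂]
  obtain ⟨c, hc⟩ := hs.exists_desc h _ h₃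
  have hn : (b ≫ b - b) ≫ (b ≫ b - b) = 0 := by
    nth_rw 2 [hc]
    rw [reassoc_of% h₄, zero_comp]
  -- This is `(b² - b)² = 0` expanded; modulo this relation `3b² - 2b³` is idempotent, and it still
  -- induces `q` and `p` since these are idempotent.
  have hb : b ≫ b ≫ b ≫ b = b ≫ b ≫ b + b ≫ b ≫ b - b ≫ b := by
    simp only [Preadditive.sub_comp, Preadditive.comp_sub, Category.assoc] at hn
    rw [← sub_eq_zero, ← hn]; abel
  refine ⟨b ≫ b + b ≫ b + b ≫ b - b ≫ b ≫ b - b ≫ b ≫ b, ?_, ?_, ?_⟩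
  · simp only [Preadditive.sub_comp, Preadditive.comp_sub, Preadditive.add_comp,
      Preadditive.comp_add, Category.assoc, hb]
    abel
  · simp [reassoc_of% h₁, h₁]
  · simp [h₂, reassoc_of% h₂]

theorem karoubiCls_eq {P Q : Karoubi C} {δ : ExtGroup E P.X Q.X} {Y Y' : C} {x : Q.X ⟶ Y}
    {y : Y ⟶ P.X} (h : s δ = cls x y) {r : Y ⟶ Y} (hr : IsIdempotentLift P Q x y r)
    {x' : Q.X ⟶ Y'} {y' : Y' ⟶ P.X} (h' : s δ = cls x' y') {r' : Y' ⟶ Y'}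
    (hr' : IsIdempotentLift P Q x' y' r') :
    karoubiCls P Q x y r hr = karoubiCls P Q x' y' r' hr' := by
  obtain ⟨b, rfl, rfl⟩ := (cls_eq_iff _ _ _ _).1 (h.symm.trans h')
  have l₁ := hr'.left
  have r₁ := hr.right
  simp only [Category.assoc] at l₁ r₁
  -- The isomorphism `b` need not intertwine `r` and `r'`, so it is cut down to `r ≫ b ≫ r'`. This
  -- need not be inverse to its counterpart, but both are the identity on the ends, which suffices.
  refine cls_eq_of_weakExact ((hs.weakExact h).karoubi hr rfl) ((hs.weakExact h').karoubi hr' rfl)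
    ⟨r ≫ b.hom ≫ r', ?_⟩ ⟨r' ≫ b.inv ≫ r, ?_⟩ ?_ ?_ ?_ ?_
  · simp [reassoc_of% hr.idem, hr'.idem]
  · simp [reassoc_of% hr'.idem, hr.idem]
  · ext; simp [reassoc_of% hr.left, l₁]
  · ext; simp [reassoc_of% hr'.right, reassoc_of% r₁]
  · ext; simp [reassoc_of% l₁, hr.left]
  · ext; simp [reassoc_of% hr'.right, reassoc_of% r₁]

theorem exists_karoubiCls {P Q : Karoubi C} (δ : ExtGroup (karoubiExt E) P Q) :
    ∃ S : SeqClass Q P, ∀ (Y : C) (x : Q.X ⟶ Y) (y : Y ⟶ P.X), s (karoubiVal E δ) = cls x y →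
      ∀ (r : Y ⟶ Y) (hr : IsIdempotentLift P Q x y r), S = karoubiCls P Q x y r hr := by
  obtain ⟨Y, x, y, h⟩ := exists_rep (s (karoubiVal E δ))
  obtain ⟨r, hr⟩ := hs.exists_isIdempotentLift (push_karoubiVal δ) (pull_karoubiVal δ) h
  exact ⟨karoubiCls P Q x y r hr, fun Y' x' y' h' r' hr' => hs.karoubiCls_eq h hr h' hr'⟩

end IsExtriangulated

/-- The realisation of `karoubiExt E` induced by a realisation of `E`. -/
noncomputable def karoubiRealisation (hs : IsExtriangulated E s) :
    Correspondence (karoubiExt E) :=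
  fun _ _ δ => (hs.exists_karoubiCls δ).choose

theorem karoubiRealisation_eq (hs : IsExtriangulated E s) {P Q : Karoubi C}
    (δ : ExtGroup (karoubiExt E) P Q) {Y : C} {x : Q.X ⟶ Y} {y : Y ⟶ P.X}
    (h : s (karoubiVal E δ) = cls x y) {r : Y ⟶ Y} (hr : IsIdempotentLift P Q x y r) :
    karoubiRealisation hs δ = karoubiCls P Q x y r hr :=
  (hs.exists_karoubiCls δ).choose_spec Y x y h r hr

theorem karoubiRealisation_eq_cls (hs : IsExtriangulated E s) {P Q M : Karoubi C}
    {δ : ExtGroup (karoubiExt E) P Q} {Y : C} {x₀ : Q.X ⟶ Y} {y₀ : Y ⟶ P.X}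
    (h : s (karoubiVal E δ) = cls x₀ y₀) {i : Y ⟶ M.X} {j : M.X ⟶ Y} {x : Q ⟶ M} {y : M ⟶ P}
    (hij : IsDirectFactor x₀ y₀ i j x y) : karoubiRealisation hs δ = cls x y :=
  (karoubiRealisation_eq hs δ h hij.isIdempotentLift).trans hij.karoubiCls_eq

theorem exists_of_karoubiRealisation_eq_cls (hs : IsExtriangulated E s) {P Q M : Karoubi C}
    {δ : ExtGroup (karoubiExt E) P Q} {x : Q ⟶ M} {y : M ⟶ P}
    (h : karoubiRealisation hs δ = cls x y) :
    ∃ (Y : C) (x₀ : Q.X ⟶ Y) (y₀ : Y ⟶ P.X) (i : Y ⟶ M.X) (j : M.X ⟶ Y),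
      s (karoubiVal E δ) = cls x₀ y₀ ∧ IsDirectFactor x₀ y₀ i j x y := by
  obtain ⟨Y, x₀, y₀, h₀⟩ := exists_rep (s (karoubiVal E δ))
  obtain ⟨r, hr⟩ := hs.exists_isIdempotentLift (push_karoubiVal δ) (pull_karoubiVal δ) h₀
  obtain ⟨i, j, hij, -⟩ := exists_isDirectFactor hr ((karoubiRealisation_eq hs δ h₀ hr).symm.trans h)
  exact ⟨Y, x₀, y₀, i, j, h₀, hij⟩

theorem weakExact_of_karoubiRealisation (hs : IsExtriangulated E s) ⦃A B Z : Karoubi C⦄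
    (δ : ExtGroup (karoubiExt E) Z A) (x : A ⟶ B) (y : B ⟶ Z)
    (h : karoubiRealisation hs δ = cls x y) : WeakExact x y := by
  obtain ⟨Y, x₀, y₀, i, j, h₀, hij⟩ := exists_of_karoubiRealisation_eq_cls hs h
  exact (hs.weakExact h₀).karoubi hij.isIdempotentLift hij.karoubiCls_eq

theorem karoubiRealisation_isRealisation (hs : IsExtriangulated E s) :
    IsRealisation (karoubiExt E) (karoubiRealisation hs) := by
  intro A B Z A' B' Z' δ δ' x y x' y' h h' a c hac
  obtain ⟨Y, x₀, y₀, i, j, h₀, hij⟩ := exists_of_karoubiRealisation_eq_cls hs h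
  obtain ⟨Y', x₀', y₀', i', j', h₀', hij'⟩ := exists_of_karoubiRealisation_eq_cls hs h'
  obtain ⟨b, h₁, h₂⟩ := hs.realisation _ _ x₀ y₀ x₀' y₀' h₀ h₀' a.f c.f
    (congrArg (karoubiVal E) hac)
  refine ⟨⟨j ≫ b ≫ i', by simp [reassoc_of% hij.pj, hij'.ip]⟩, ?_, ?_⟩
  · ext
    simp [reassoc_of% hij.xj, reassoc_of% h₁, hij'.xi]
  · ext
    simp [hij'.iy, reassoc_of% h₂, reassoc_of% hij.jy]

theorem karoubiRealisation_et3 (hs : IsExtriangulated E s) ⦃A B Z A' B' Z' : Karoubi C⦄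
    (δ : ExtGroup (karoubiExt E) Z A) (δ' : ExtGroup (karoubiExt E) Z' A')
    (x : A ⟶ B) (y : B ⟶ Z) (x' : A' ⟶ B') (y' : B' ⟶ Z')
    (h : karoubiRealisation hs δ = cls x y) (h' : karoubiRealisation hs δ' = cls x' y')
    (a : A ⟶ A') (b : B ⟶ B') (hab : x ≫ b = a ≫ x') :
    ∃ c : Z ⟶ Z', push (karoubiExt E) a δ = pull (karoubiExt E) c δ' ∧ b ≫ y' = y ≫ c := by
  obtain ⟨Y, x₀, y₀, i, j, h₀, hij⟩ := exists_of_karoubiRealisation_eq_cls hs h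
  obtain ⟨Y', x₀', y₀', i', j', h₀', hij'⟩ := exists_of_karoubiRealisation_eq_cls hs h'
  have hab' : x.f ≫ b.f = a.f ≫ x'.f := congrArg Karoubi.Hom.f hab
  -- The map `b` of direct factors is extended by zero on the complement. The resulting `c` is then
  -- cut down by the end idempotents, which is harmless because they fix the extensions.
  obtain ⟨c, hc₁, hc₂⟩ := hs.et3 _ _ x₀ y₀ x₀' y₀' h₀ h₀' a.f (i ≫ b.f ≫ j') (by
    rw [reassoc_of% hij.xi, reassoc_of% hab', hij'.xj, Karoubi.comp_p_assoc])
  refine ⟨⟨Z.p ≫ c ≫ Z'.p, by simp⟩, ?_, ?_⟩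
  · apply karoubiVal_injective
    rw [karoubiVal_push, karoubiVal_pull, ← pull_pull, ← pull_pull, pull_karoubiVal, ← hc₁,
      ← push_pull, pull_karoubiVal]
  · ext
    have := j ≫= hc₂ =≫ Z'.p
    simp only [Category.assoc, hij'.jy, reassoc_of% hij.ji, reassoc_of% hij.jy] at this
    simpa using this

theorem karoubiRealisation_et3_op (hs : IsExtriangulated E s) ⦃A B Z A' B' Z' : Karoubi C⦄
    (δ : ExtGroup (karoubiExt E) Z A) (δ' : ExtGroup (karoubiExt E) Z' A')
    (x : A ⟶ B) (y : B ⟶ Z) (x' : A' ⟶ B') (y' : B' ⟶ Z')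
    (h : karoubiRealisation hs δ = cls x y) (h' : karoubiRealisation hs δ' = cls x' y')
    (b : B ⟶ B') (c : Z ⟶ Z') (hbc : b ≫ y' = y ≫ c) :
    ∃ a : A ⟶ A', push (karoubiExt E) a δ = pull (karoubiExt E) c δ' ∧ x ≫ b = a ≫ x' := by
  obtain ⟨Y, x₀, y₀, i, j, h₀, hij⟩ := exists_of_karoubiRealisation_eq_cls hs h
  obtain ⟨Y', x₀', y₀', i', j', h₀', hij'⟩ := exists_of_karoubiRealisation_eq_cls hs h'
  have hbc' : b.f ≫ y'.f = y.f ≫ c.f := congrArg Karoubi.Hom.f hbc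
  obtain ⟨a, ha₁, ha₂⟩ := hs.et3_op _ _ x₀ y₀ x₀' y₀' h₀ h₀' (i ≫ b.f ≫ j') c.f (by
    rw [Category.assoc, Category.assoc, hij'.jy, hbc', reassoc_of% hij.iy, Karoubi.p_comp])
  refine ⟨⟨A.p ≫ a ≫ A'.p, by simp⟩, ?_, ?_⟩
  · apply karoubiVal_injective
    rw [karoubiVal_push, karoubiVal_pull, ← push_push, ← push_push, push_karoubiVal, ha₁,
      push_pull, push_karoubiVal]
  · ext
    have := A.p ≫= ha₂ =≫ i'
    simp only [Category.assoc, hij'.xi, reassoc_of% hij.xi, hij'.ji] at this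
    simpa using this

theorem karoubiRealisation_zero (hs : IsExtriangulated E s) (Z A : Karoubi C) :
    karoubiRealisation hs (0 : ExtGroup (karoubiExt E) Z A) = zeroCls A Z := by
  have e₁ := congrArg Karoubi.Hom.f (biprod.inl_fst (X := A) (Y := Z))
  have e₂ := congrArg Karoubi.Hom.f (biprod.inl_snd (X := A) (Y := Z))
  have e₄ := congrArg Karoubi.Hom.f (biprod.inr_snd (X := A) (Y := Z))
  have e₅ := congrArg Karoubi.Hom.f (biprod.total (X := A) (Y := Z))
  simp only [Karoubi.comp_f, Karoubi.id_f, zero_def, add_def] at e₁ e₂ e₄ e₅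
  -- The biproduct in the completion is an unspecified one; its structure maps exhibit it as a
  -- direct factor of the biproduct of underlying objects.
  refine karoubiRealisation_eq_cls hs (x₀ := biprod.inl) (y₀ := biprod.snd)
    (δ := (0 : ExtGroup (karoubiExt E) Z A))
    (hs.realisation_zero Z.X A.X)
    (i := biprod.desc (biprod.inl : A ⟶ A ⊞ Z).f (biprod.inr : Z ⟶ A ⊞ Z).f)
    (j := biprod.lift (biprod.fst : A ⊞ Z ⟶ A).f (biprod.snd : A ⊞ Z ⟶ Z).f)
    ⟨?_, ?_, ?_, ?_, ?_, ?_, ?_⟩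
  · simpa using e₅
  · ext <;> simp
  · ext <;> simp
  · simp
  · ext <;> simp [e₁, e₂]
  · simp
  · ext <;> simp [e₂, e₄]

/-- On objects `(X, 1)` the defining subgroup is all of `E(Z, A)`, so `Γ` is the identity on
elements and the direct factor is the whole sequence. -/
theorem toKaroubi_isExtriangulatedFunctor (hs : IsExtriangulated E s) :
    IsExtriangulatedFunctor E s (karoubiExt E) (karoubiRealisation hs) (toKaroubi C) := by
  refine ⟨inferInstance,
    { app := fun Z =>
        { app := fun A => AddCommGrpCat.ofHom
            { toFun := fun δ => karoubiMk (P := (toKaroubi C).obj Z.unop)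
                (Q := (toKaroubi C).obj A) δ (push_id E δ) (pull_id E δ)
              map_zero' := rfl
              map_add' := fun _ _ => rfl }
          naturality := fun A A' f => by ext δ; rfl }
      naturality := fun Z Z' f => by ext A δ; rfl }, ?_⟩
  intro A B Z δ x y h
  exact karoubiRealisation_eq_cls hs (P := (toKaroubi C).obj Z) (Q := (toKaroubi C).obj A)
    (M := (toKaroubi C).obj B) (x := (toKaroubi C).map x) (y := (toKaroubi C).map y)
    (δ := karoubiMk δ (push_id E δ) (pull_id E δ)) (x₀ := x) (y₀ := y) h (i := 𝟙 B) (j := 𝟙 B)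
    ⟨by simp, by simp, by simp, by simp, by simp, by simp, by simp⟩

end KaroubiRealisation

/-! ### Compatible idempotents on octahedra, and (ET4) with its dual. -/

section Octahedron

variable {C : Type u} [Category.{v} C] {E : Cᵒᵖ ⥤ C ⥤ AddCommGrpCat.{w}}
  [Preadditive C]

theorem idem_id_sub_sub {X : C} {a b : X ⟶ X} (ha : a ≫ a = a) (hb : b ≫ b = b)
    (hab : a ≫ b = 0) (hba : b ≫ a = 0) : (𝟙 X - a - b) ≫ (𝟙 X - a - b) = 𝟙 X - a - b := by
  simp [ha, hb, hab, hba]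

variable [HasFiniteBiproducts C] {s : Correspondence E}

namespace IsExtriangulated

variable (hs : IsExtriangulated E s)
include hs

/-- The square of (ET4) is a weak pushout: `α` extends along `d` because `g` annihilates `δ`, and
the failure to restrict to `β` kills `g`, hence factors through `g' = h ≫ e` and can be corrected
without changing the restriction to `d`. -/
theorem exists_pushout_desc {B D K F L : C} {δ : ExtGroup E F B} {g : B ⟶ K} {g' : K ⟶ F}
    (hg : s δ = cls g g') {f : B ⟶ D} {d : D ⟶ L} {e : L ⟶ F} (hd : s (push E f δ) = cls d e)
    {h : K ⟶ L} (h₁ : f ≫ d = g ≫ h) (h₂ : h ≫ e = g') {T : C} (α : D ⟶ T) (β : K ⟶ T)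
    (hαβ : f ≫ α = g ≫ β) : ∃ γ : L ⟶ T, d ≫ γ = α ∧ h ≫ γ = β := by
  obtain ⟨γ, hγ⟩ := hs.exists_extension hd α (by
    rw [push_push, hαβ, ← push_push, hs.push_eq_zero hg, push_zero])
  obtain ⟨η, hη⟩ := hs.exists_desc hg (β - h ≫ γ) (by
    rw [Preadditive.comp_sub, ← reassoc_of% h₁, hγ, hαβ, sub_self])
  refine ⟨γ + e ≫ η, ?_, ?_⟩
  · rw [Preadditive.comp_add, hγ, reassoc_of% hs.comp_eq_zero hd, zero_comp, add_zero]
  · rw [Preadditive.comp_add, reassoc_of% h₂, ← hη, add_sub_cancel]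

theorem exists_pullback_lift {D A B F L : C} {δ : ExtGroup E B D} {f' : D ⟶ A} {f : A ⟶ B}
    (hf : s δ = cls f' f) {g : F ⟶ B} {d : D ⟶ L} {e : L ⟶ F} (hd : s (pull E g δ) = cls d e)
    {h : L ⟶ A} (h₁ : h ≫ f = e ≫ g) (h₂ : d ≫ h = f') {T : C} (α : T ⟶ F) (β : T ⟶ A)
    (hαβ : α ≫ g = β ≫ f) : ∃ γ : T ⟶ L, γ ≫ e = α ∧ γ ≫ h = β := by
  obtain ⟨γ, hγ⟩ := hs.exists_lifting hd α (by
    rw [pull_pull, hαβ, ← pull_pull, hs.pull_eq_zero hf, pull_zero])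
  obtain ⟨η, hη⟩ := hs.exists_lift hf (β - γ ≫ h) (by
    rw [Preadditive.sub_comp, Category.assoc, h₁, reassoc_of% hγ, hαβ, sub_self])
  refine ⟨γ + η ≫ d, ?_, ?_⟩
  · rw [Preadditive.add_comp, hγ, Category.assoc, hs.comp_eq_zero hd, comp_zero, add_zero]
  · rw [Preadditive.add_comp, Category.assoc, h₂, ← hη, add_sub_cancel]

/-- The octahedron of (ET4) can be equipped with compatible idempotents. -/
theorem exists_octahedron_idempotents {A D F : Karoubi C} {Y K : C} {δ : ExtGroup E D.X A.X}
    (hA : push E A.p δ = δ) (hD : pull E D.p δ = δ) {x : A.X ⟶ Y} {y : Y ⟶ D.X}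
    (hxy : s δ = cls x y) {r : Y ⟶ Y} (hr : IsIdempotentLift D A x y r) {δ' : ExtGroup E F.X Y}
    (hY : push E r δ' = δ') (hF : pull E F.p δ' = δ') {g : Y ⟶ K} {g' : K ⟶ F.X}
    (hg : s δ' = cls g g') :
    ∃ (k : K ⟶ K) (L : C) (l : L ⟶ L) (d : D.X ⟶ L) (e : L ⟶ F.X) (h : K ⟶ L)
      (δ'' : ExtGroup E L A.X),
      IsIdempotentLift F (Karoubi.mk Y r hr.idem) g g' k ∧ IsIdempotentLift F D d e l ∧
      h ≫ l = k ≫ h ∧ push E A.p δ'' = δ'' ∧ pull E l δ'' = δ'' ∧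
      y ≫ d = g ≫ h ∧ h ≫ e = g' ∧ s δ'' = cls (x ≫ g) h ∧ s (push E y δ') = cls d e ∧
      pull E d δ'' = δ ∧ push E x δ'' = pull E e δ' := by
  have hE := hs.isBiadditive
  obtain ⟨L, d, e, _, h, δ'', rfl, h₁, h₂, h₃, h₄, h₅, h₆⟩ := hs.et4 δ δ' x y g g' hxy hg
  have hgg := hs.comp_eq_zero hg
  have hde := hs.comp_eq_zero h₄
  have rr := hr.idem
  have rx := hr.left
  have ry := hr.right
  obtain ⟨σ, hσ⟩ := hs.exists_lifting hxy (𝟙 _ - D.p) (by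
    rw [hE.sub_pull, pull_id, hD, sub_self])
  obtain ⟨ρ, hρ⟩ := hs.exists_extension hxy (𝟙 _ - A.p) (by
    rw [hE.sub_push, push_id, hA, sub_self])
  -- `τ` and `m` split the complement of the sequence `g, g'`. The normalisations `F.p ≫ τ = 0`, `m
  -- ≫ r = 0` and `τ ≫ m = 0` make `m ≫ g` and `g' ≫ τ` orthogonal idempotents.
  obtain ⟨τ, hτ, hτF⟩ : ∃ τ : F.X ⟶ K, τ ≫ g' = 𝟙 _ - F.p ∧ F.p ≫ τ = 0 := by
    obtain ⟨τ, hτ⟩ := hs.exists_lifting hg (𝟙 _ - F.p) (by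
      rw [hE.sub_pull, pull_id, hF, sub_self])
    exact ⟨(𝟙 _ - F.p) ≫ τ, by simp [hτ], by simp⟩
  obtain ⟨m, hm, hmr, hτm⟩ : ∃ m : K ⟶ Y, g ≫ m = 𝟙 _ - r ∧ m ≫ r = 0 ∧ τ ≫ m = 0 := by
    obtain ⟨m, hm⟩ := hs.exists_extension hg (𝟙 _ - r) (by
      rw [hE.sub_push, push_id, hY, sub_self])
    refine ⟨(m - g' ≫ τ ≫ m) ≫ (𝟙 _ - r), ?_, ?_, ?_⟩
    · simp [reassoc_of% hm, hm, reassoc_of% hgg, rr]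
    · simp [rr]
    · simp [reassoc_of% hτ, reassoc_of% hτF]
  -- `π` plays the role of `m` for the sequence `d, e`. Taking it from the weak pushout allows `h ≫
  -- π = m ≫ y`, which is what makes the idempotents on `K` and `L` commute with `h`.
  obtain ⟨π, hdπ, hhπ, hπD⟩ : ∃ π : L ⟶ D.X, d ≫ π = 𝟙 _ - D.p ∧ h ≫ π = m ≫ y ∧
      π ≫ D.p = 0 := by
    obtain ⟨π, hdπ, hhπ⟩ := hs.exists_pushout_desc hg h₄ h₁ h₂ (𝟙 _ - D.p) (m ≫ y) (by
      simp [reassoc_of% hm, ry])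
    refine ⟨π ≫ (𝟙 _ - D.p), ?_, ?_, ?_⟩
    · simp [reassoc_of% hdπ, hdπ]
    · rw [reassoc_of% hhπ, Preadditive.comp_sub, Category.comp_id, Preadditive.comp_sub, ← ry,
        reassoc_of% hmr, zero_comp, sub_zero]
    · simp
  refine ⟨𝟙 K - m ≫ g - g' ≫ τ, L, 𝟙 L - π ≫ d - e ≫ τ ≫ h, d, e, h, δ'', ⟨?_, ?_, ?_⟩,
    ⟨?_, ?_, ?_⟩, ?_, ?_, ?_, h₁, h₂, h₃, h₄, h₅, h₆⟩
  · apply idem_id_sub_sub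
    · simp [reassoc_of% hm, reassoc_of% hmr]
    · simp [reassoc_of% hτ, hτF]
    · simp [reassoc_of% hgg]
    · simp [reassoc_of% hτm]
  · simp [reassoc_of% hm, reassoc_of% hgg]
  · simp [hτ, hgg]
  · apply idem_id_sub_sub
    · simp [reassoc_of% hdπ, reassoc_of% hπD]
    · simp [reassoc_of% h₂, reassoc_of% hτ, reassoc_of% hτF]
    · simp [reassoc_of% hde]
    · simp [reassoc_of% hhπ, reassoc_of% hτm]
  · simp [reassoc_of% hdπ, reassoc_of% hde]
  · simp [hde, h₂, hτ]
  · simp [reassoc_of% hhπ, reassoc_of% h₂, h₁]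
  -- `1 - A.p` factors through the first map of the sequence of `δ''`, so it annihilates `δ''`.
  · have : (x ≫ g) ≫ m ≫ ρ = 𝟙 _ - A.p := by
      rw [Category.assoc, reassoc_of% hm, Preadditive.sub_comp, Preadditive.comp_sub,
        Category.id_comp, reassoc_of% rx, hρ]
      simp
    have h₀ : push E (𝟙 _ - A.p) δ'' = 0 := by
      rw [← this, ← push_push, hs.push_eq_zero h₃, push_zero]
    rw [hE.sub_push, push_id, sub_eq_zero] at h₀
    exact h₀.symm
  -- Both summands of `1 - l` factor through `h`, the second map of the sequence of `δ''`, hence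
  -- pull `δ''` back to zero.
  · have : π ≫ d = (π ≫ σ ≫ g) ≫ h := by
      simp only [Category.assoc]
      rw [← h₁, reassoc_of% hσ, Preadditive.sub_comp, Preadditive.comp_sub, Category.id_comp,
        reassoc_of% hπD, zero_comp, sub_zero]
    rw [this, ← Category.assoc e, hE.sub_pull, hE.sub_pull, ← pull_pull E h, ← pull_pull E h,
      hs.pull_eq_zero h₃, pull_zero, pull_zero, pull_id, sub_zero, sub_zero]

/-- The octahedron of (ET4)ᵒᵖ can be equipped with compatible idempotents. -/
theorem exists_octahedron_op_idempotents {D F K : Karoubi C} {Y A : C}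
    {δ' : ExtGroup E K.X F.X} (hF : push E F.p δ' = δ') (hK : pull E K.p δ' = δ')
    {x : F.X ⟶ Y} {y : Y ⟶ K.X} (hxy : s δ' = cls x y) {r : Y ⟶ Y}
    (hr : IsIdempotentLift K F x y r) {δ : ExtGroup E Y D.X} (hD : push E D.p δ = δ)
    (hY : pull E r δ = δ) {f' : D.X ⟶ A} {f : A ⟶ Y} (hf : s δ = cls f' f) :
    ∃ (a : A ⟶ A) (L : C) (l : L ⟶ L) (d : D.X ⟶ L) (e : L ⟶ F.X) (h : L ⟶ A)
      (δ'' : ExtGroup E K.X L),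
      IsIdempotentLift (Karoubi.mk Y r hr.idem) D f' f a ∧ IsIdempotentLift F D d e l ∧
      l ≫ h = h ≫ a ∧ push E l δ'' = δ'' ∧ pull E K.p δ'' = δ'' ∧
      h ≫ f = e ≫ x ∧ d ≫ h = f' ∧ s δ'' = cls h (f ≫ y) ∧ s (pull E x δ) = cls d e ∧
      push E e δ'' = δ' ∧ pull E y δ'' = push E d δ := by
  have hE := hs.isBiadditive
  obtain ⟨L, d, e, h, _, δ'', rfl, h₁, h₂, h₃, h₄, h₅, h₆⟩ := hs.et4_op δ δ' f' f x y hf hxy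
  have hff := hs.comp_eq_zero hf
  have hde := hs.comp_eq_zero h₄
  have rr := hr.idem
  have rx := hr.left
  have ry := hr.right
  obtain ⟨σ, hσ⟩ := hs.exists_extension hxy (𝟙 _ - F.p) (by
    rw [hE.sub_push, push_id, hF, sub_self])
  obtain ⟨ρ, hρ⟩ := hs.exists_lifting hxy (𝟙 _ - K.p) (by
    rw [hE.sub_pull, pull_id, hK, sub_self])
  obtain ⟨τ, hτ, hτD⟩ : ∃ τ : A ⟶ D.X, f' ≫ τ = 𝟙 _ - D.p ∧ τ ≫ D.p = 0 := by
    obtain ⟨τ, hτ⟩ := hs.exists_extension hf (𝟙 _ - D.p) (by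
      rw [hE.sub_push, push_id, hD, sub_self])
    exact ⟨τ ≫ (𝟙 _ - D.p), by simp [reassoc_of% hτ, hτ], by simp⟩
  obtain ⟨m, hm, hmr, hmτ⟩ : ∃ m : Y ⟶ A, m ≫ f = 𝟙 _ - r ∧ r ≫ m = 0 ∧ m ≫ τ = 0 := by
    obtain ⟨m, hm⟩ := hs.exists_lifting hf (𝟙 _ - r) (by
      rw [hE.sub_pull, pull_id, hY, sub_self])
    refine ⟨(𝟙 _ - r) ≫ (m - m ≫ τ ≫ f'), ?_, ?_, ?_⟩
    · simp [hm, hff, rr]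
    · simp [reassoc_of% rr]
    · simp [hτ, hτD]
  obtain ⟨π, hπe, hπh, hπF⟩ : ∃ π : F.X ⟶ L, π ≫ e = 𝟙 _ - F.p ∧ π ≫ h = x ≫ m ∧
      F.p ≫ π = 0 := by
    obtain ⟨π, hπe, hπh⟩ := hs.exists_pullback_lift hf h₄ h₁ h₂ (𝟙 _ - F.p) (x ≫ m) (by
      simp [hm, rx])
    refine ⟨(𝟙 _ - F.p) ≫ π, ?_, ?_, ?_⟩
    · simp [hπe]
    · rw [Category.assoc, hπh, Preadditive.sub_comp, Category.id_comp, ← reassoc_of% rx, hmr,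
        comp_zero, sub_zero]
    · simp
  -- Dually, `π` comes from a weak pullback, and `π ≫ h = x ≫ m` gives compatibility with `h`.
  refine ⟨𝟙 A - f ≫ m - τ ≫ f', L, 𝟙 L - e ≫ π - h ≫ τ ≫ d, d, e, h, δ'', ⟨?_, ?_, ?_⟩,
    ⟨?_, ?_, ?_⟩, ?_, ?_, ?_, h₁, h₂, h₃, h₄, h₅, h₆⟩
  · apply idem_id_sub_sub
    · simp [reassoc_of% hm, hmr]
    · simp [reassoc_of% hτ, reassoc_of% hτD]
    · simp [reassoc_of% hmτ]
    · simp [reassoc_of% hff]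
  · simp [reassoc_of% hτ, reassoc_of% hff]
  · simp [hm, hff]
  · apply idem_id_sub_sub
    · simp [reassoc_of% hπe, hπF]
    · simp [reassoc_of% h₂, reassoc_of% hτ, reassoc_of% hτD]
    · simp [reassoc_of% hπh, reassoc_of% hmτ]
    · simp [reassoc_of% hde]
  · simp [reassoc_of% hde, reassoc_of% h₂, reassoc_of% hτ]
  · simp [hde, hπe]
  · simp [hπh, h₂, reassoc_of% h₁]
  · have : e ≫ π = h ≫ f ≫ σ ≫ π := by
      rw [reassoc_of% h₁, reassoc_of% hσ, Preadditive.sub_comp, Category.id_comp, hπF, sub_zero]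
    rw [this, hE.sub_push, hE.sub_push, ← push_push E h, ← push_push E h,
      hs.push_eq_zero h₃, push_zero, push_zero, push_id, sub_zero, sub_zero]
  · have : (ρ ≫ m) ≫ f ≫ y = 𝟙 _ - K.p := by
      rw [Category.assoc, reassoc_of% hm, Preadditive.sub_comp, Preadditive.comp_sub,
        Category.id_comp, ry, reassoc_of% hρ, hρ]
      simp
    have h₀ : pull E (𝟙 _ - K.p) δ'' = 0 := by
      rw [← this, ← pull_pull, hs.pull_eq_zero h₃, pull_zero]
    rw [hE.sub_pull, pull_id, sub_eq_zero] at h₀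
    exact h₀.symm

end IsExtriangulated

/-- The isomorphism from the direct factor cut out by the idempotent `i ≫ j`. -/
def IsDirectFactor.iso {P Q M : Karoubi C} {Y : C} {x₀ : Q.X ⟶ Y}
    {y₀ : Y ⟶ P.X} {i : Y ⟶ M.X} {j : M.X ⟶ Y} {x : Q ⟶ M} {y : M ⟶ P}
    (h : IsDirectFactor x₀ y₀ i j x y) : Karoubi.mk Y (i ≫ j) h.isIdempotentLift.idem ≅ M where
  hom := ⟨i, by simp [h.ip, h.ji]⟩
  inv := ⟨j, by simp [h.comp_idem, h.pj]⟩
  hom_inv_id := by ext; simp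
  inv_hom_id := by ext; simp [h.ji]

/-- The middle term `B` is a direct factor of some `Y` realising `δ` in `C`. Pushing `δ'` along `j :
B.X ⟶ Y` gives two composable sequences in `C`; the octahedron sought is the part of theirs cut out
by the compatible idempotents. -/
theorem karoubiRealisation_et4 (hs : IsExtriangulated E s) ⦃A B D K F : Karoubi C⦄
    (δ : ExtGroup (karoubiExt E) D A) (δ' : ExtGroup (karoubiExt E) F B)
    (f : A ⟶ B) (f' : B ⟶ D) (g : B ⟶ K) (g' : K ⟶ F)
    (hf : karoubiRealisation hs δ = cls f f') (hg : karoubiRealisation hs δ' = cls g g') :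
    ∃ (L : Karoubi C) (d : D ⟶ L) (e : L ⟶ F) (h : A ⟶ K) (h' : K ⟶ L)
      (δ'' : ExtGroup (karoubiExt E) L A),
      f ≫ g = h ∧ f' ≫ d = g ≫ h' ∧ h' ≫ e = g' ∧
      karoubiRealisation hs δ'' = cls h h' ∧
      karoubiRealisation hs (push (karoubiExt E) f' δ') = cls d e ∧
      pull (karoubiExt E) d δ'' = δ ∧
      push (karoubiExt E) f δ'' = pull (karoubiExt E) e δ' := by
  obtain ⟨Y, x, y, i, j, hxy, hij⟩ := exists_of_karoubiRealisation_eq_cls hs hf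
  have hg₁ := realisation_push_iso (karoubiRealisation_isRealisation hs)
    (weakExact_of_karoubiRealisation hs) δ' g g' hg hij.iso.symm
  obtain ⟨K₀, g₀, g₀', hg₀⟩ := exists_rep (s (push E j (karoubiVal E δ')))
  obtain ⟨k, L, l, d, e, h, δ'', hk, hl, hhl, hA, hL, h₁, h₂, h₃, h₄, h₅, h₆⟩ :=
    hs.exists_octahedron_idempotents (push_karoubiVal δ) (pull_karoubiVal δ) hxy
      hij.isIdempotentLift (F := F) (by rw [push_push, hij.comp_idem])
      (by rw [← push_pull, pull_karoubiVal]) hg₀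
  obtain ⟨i', j', hij', rfl⟩ := exists_isDirectFactor hk
    ((karoubiRealisation_eq hs (push (karoubiExt E) hij.iso.inv δ') hg₀ hk).symm.trans hg₁)
  have hxi : g₀ ≫ i' = i ≫ g.f := hij'.xi
  have hxj : (i ≫ g.f) ≫ j' = (i ≫ j) ≫ g₀ := hij'.xj
  have hjy := hij'.jy
  have dl := hl.left
  have le := hl.right
  have ll := hl.idem
  -- `hxj` gives this only after composing with `i`; precomposition with `j` removes it, as `j ≫ i`
  -- is the identity of `B` in the completion.
  have hgj : g.f ≫ j' = j ≫ g₀ := by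
    rw [← Karoubi.p_comp g, ← hij.ji, Category.assoc, Category.assoc, ← Category.assoc i, hxj,
      Category.assoc, reassoc_of% hij.comp_idem]
  have hjh : j' ≫ h ≫ l = j' ≫ h := by
    rw [hhl, Category.assoc, reassoc_of% hij'.comp_idem]
  refine ⟨Karoubi.mk L l ll, ⟨D.p ≫ d, by simp [dl]⟩,
    ⟨e ≫ F.p, by simp [reassoc_of% le]⟩, f ≫ g, ⟨j' ≫ h, by
      simp [hjh, reassoc_of% hij'.pj]⟩, karoubiMk δ'' hA hL, rfl, ?_, ?_, ?_, ?_, ?_, ?_⟩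
  · ext
    simp only [Karoubi.comp_f, Karoubi.comp_p_assoc]
    rw [← hij.jy, Category.assoc, h₁, reassoc_of% hgj]
  · ext
    simp only [Karoubi.comp_f, Category.assoc]
    rw [reassoc_of% h₂, reassoc_of% hjy, Karoubi.comp_p]
  · refine karoubiRealisation_eq_cls hs (P := Karoubi.mk L l ll) (Q := A)
      (δ := karoubiMk δ'' hA hL) h₃ (i := i') (j := j')
      ⟨hij'.ji, hij'.ip, hij'.pj, ?_, ?_, rfl, ?_⟩
    · simp [hxi, reassoc_of% hij.xi]
    · simp [hgj, reassoc_of% hij.xj]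
    · simp [hhl]
  · have : karoubiVal E (push (karoubiExt E) f' δ') = push E y (push E j (karoubiVal E δ')) := by
      rw [karoubiVal_push, push_push, hij.jy]
    exact karoubiRealisation_eq hs _ (by rw [this]; exact h₄) hl
  · apply karoubiVal_injective
    rw [karoubiVal_pull, karoubiVal_mk, ← pull_pull, h₅, pull_karoubiVal]
  · apply karoubiVal_injective
    rw [karoubiVal_pull, karoubiVal_push, karoubiVal_mk, ← pull_pull, pull_karoubiVal, ← hij.xi,
      ← push_push, h₆, push_pull, push_push, hij.ji, push_karoubiVal]

theorem karoubiRealisation_et4_op (hs : IsExtriangulated E s) ⦃D A B F K : Karoubi C⦄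
    (δ : ExtGroup (karoubiExt E) B D) (δ' : ExtGroup (karoubiExt E) K F)
    (f' : D ⟶ A) (f : A ⟶ B) (g' : F ⟶ B) (g : B ⟶ K)
    (hf : karoubiRealisation hs δ = cls f' f) (hg : karoubiRealisation hs δ' = cls g' g) :
    ∃ (L : Karoubi C) (d : D ⟶ L) (e : L ⟶ F) (h' : L ⟶ A) (h : A ⟶ K)
      (δ'' : ExtGroup (karoubiExt E) K L),
      f ≫ g = h ∧ h' ≫ f = e ≫ g' ∧ d ≫ h' = f' ∧
      karoubiRealisation hs δ'' = cls h' h ∧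
      karoubiRealisation hs (pull (karoubiExt E) g' δ) = cls d e ∧
      push (karoubiExt E) e δ'' = δ' ∧
      pull (karoubiExt E) g δ'' = push (karoubiExt E) d δ := by
  obtain ⟨Y, x, y, i, j, hxy, hij⟩ := exists_of_karoubiRealisation_eq_cls hs hg
  have hf₁ := realisation_pull_iso (karoubiRealisation_isRealisation hs)
    (weakExact_of_karoubiRealisation hs) δ f' f hf hij.iso
  obtain ⟨A₀, f₀', f₀, hf₀⟩ := exists_rep (s (pull E i (karoubiVal E δ)))
  obtain ⟨a, L, l, d, e, h, δ'', ha, hl, hlh, hL, hK, h₁, h₂, h₃, h₄, h₅, h₆⟩ :=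
    hs.exists_octahedron_op_idempotents (push_karoubiVal δ') (pull_karoubiVal δ') hxy
      hij.isIdempotentLift (D := D) (by rw [push_pull, push_karoubiVal])
      (by rw [pull_pull, Category.assoc, hij.idem_comp]) hf₀
  obtain ⟨i', j', hij', rfl⟩ := exists_isDirectFactor ha
    ((karoubiRealisation_eq hs (pull (karoubiExt E) hij.iso.hom δ) hf₀ ha).symm.trans hf₁)
  have hjy : j' ≫ f₀ = f.f ≫ j := hij'.jy
  have hiy : i' ≫ f.f ≫ j = f₀ ≫ i ≫ j := hij'.iy
  have hxi := hij'.xi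
  have dl := hl.left
  have le := hl.right
  have ll := hl.idem
  have hif : i' ≫ f.f = f₀ ≫ i := by
    rw [← Karoubi.comp_p f, ← hij.ji, reassoc_of% hiy, hij.idem_comp]
  have hhi : l ≫ h ≫ i' = h ≫ i' := by
    rw [reassoc_of% hlh, hij'.idem_comp]
  refine ⟨Karoubi.mk L l ll, ⟨D.p ≫ d, by simp [dl]⟩,
    ⟨e ≫ F.p, by simp [reassoc_of% le]⟩, ⟨h ≫ i', by
      simp [hhi, hij'.ip]⟩, f ≫ g, karoubiMk δ'' hL hK, rfl, ?_, ?_, ?_, ?_, ?_, ?_⟩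
  · ext
    simp only [Karoubi.comp_f, Category.assoc, Karoubi.p_comp]
    rw [hif, reassoc_of% h₁, hij.xi]
  · ext
    simp only [Karoubi.comp_f, Category.assoc]
    rw [reassoc_of% h₂, hxi, Karoubi.p_comp]
  · refine karoubiRealisation_eq_cls hs (P := K) (Q := Karoubi.mk L l ll)
      (δ := karoubiMk δ'' hL hK) h₃ (i := i') (j := j')
      ⟨hij'.ji, hij'.ip, hij'.pj, rfl, ?_, ?_, ?_⟩
    · simp [hlh]
    · simp [reassoc_of% hjy, hij.jy]
    · simp [reassoc_of% hif, hij.iy]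
  · have : karoubiVal E (pull (karoubiExt E) g' δ) = pull E x (pull E i (karoubiVal E δ)) := by
      rw [karoubiVal_pull, pull_pull, hij.xi]
    exact karoubiRealisation_eq hs _ (by rw [this]; exact h₄) hl
  · apply karoubiVal_injective
    rw [karoubiVal_push, karoubiVal_mk, ← push_push, h₅, push_karoubiVal]
  · apply karoubiVal_injective
    rw [karoubiVal_pull, karoubiVal_push, karoubiVal_mk, ← push_push, push_karoubiVal, ← hij.jy,
      ← pull_pull, h₆, ← push_pull, pull_pull, hij.ji, pull_karoubiVal]

theorem karoubi_isExtriangulated (hs : IsExtriangulated E s) :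
    IsExtriangulated (karoubiExt E) (karoubiRealisation hs) where
  additive_right := (karoubiExt_isBiadditive hs.isBiadditive).right
  additive_left := (karoubiExt_isBiadditive hs.isBiadditive).left
  realisation := karoubiRealisation_isRealisation hs
  realisation_zero := karoubiRealisation_zero hs
  realisation_sum _ _ _ _ δ δ' :=
    realisation_sum_of_weakExact (karoubiExt_isBiadditive hs.isBiadditive)
      (karoubiRealisation_isRealisation hs) (weakExact_of_karoubiRealisation hs) δ δ'
  et3 := karoubiRealisation_et3 hs
  et3_op := karoubiRealisation_et3_op hs
  et4 := karoubiRealisation_et4 hs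
  et4_op := karoubiRealisation_et4_op hs

end Octahedron

end Extriangulated

theorem theorem3 {C : Type u} [Category.{v} C] [Preadditive C] [HasFiniteBiproducts C]
    (E : Cᵒᵖ ⥤ C ⥤ AddCommGrpCat.{w}) (s : Correspondence E) (hs : IsExtriangulated E s) :
    ∃ t : Correspondence (karoubiExt E),
      (∀ (P Q : Karoubi C) (δ : ExtGroup (karoubiExt E) P Q) (Y : C) (x : Q.X ⟶ Y) (y : Y ⟶ P.X),
        s (karoubiVal E δ) = cls x y →
          (∃ r : Y ⟶ Y, IsIdempotentLift P Q x y r) ∧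
          ∀ (r : Y ⟶ Y) (hr : IsIdempotentLift P Q x y r), t δ = karoubiCls P Q x y r hr) ∧
      IsExtriangulated (karoubiExt E) t ∧
      IsExtriangulatedFunctor E s (karoubiExt E) t (toKaroubi C) := by
  refine ⟨karoubiRealisation hs, fun P Q δ Y x y h => ⟨?_, fun r hr => ?_⟩,
    karoubi_isExtriangulated hs, toKaroubi_isExtriangulatedFunctor hs⟩
  · exact hs.exists_isIdempotentLift (push_karoubiVal δ) (pull_karoubiVal δ) h
  · exact karoubiRealisation_eq hs δ h hr
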